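/- Let $A\in\mathbb{R}^{N\times N}$ be consensus stable, i.e. $0$ is an eigenvalue of $A$ of algebraic multiplicity one and all other eigenvalues of $A$ lie in the open left half plane. Let $v_0,w_0\in\mathbb{R}^N$ be right and left eigenvectors for the eigenvalue $0$, $Av_0=0$ and $w_0^TA=0$, normalized by $w_0^Tv_0=1$ (that is, $v_0$ is the first column of $V$ and $w_0^T$ the first row of $V^{-1}$ in a decomposition $A=V\,\mathrm{diag}(0,\Lambda_1)\,V^{-1}$). Let $B\in\mathbb{R}^{N\times m}$, let $R\in\mathbb{R}^{m\times m}$ be symmetric with $R\succ0$, and let $Q\in\mathbb{R}^{N\times N}$ be symmetric with $Q\succeq0$ and $\ker Q=\mathrm{span}\{v_0\}$. Put $G=BR^{-1}B^T$, and for a real $\epsilon>0$ let $A_\epsilon=A-\epsilon v_0w_0^T$. Then for every $\epsilon>0$ the algebraic Riccati equation $$A_\epsilon^TX+XA_\epsilon+Q-XGX=0$$ has a unique stabilizing solution $X_\epsilon\in\mathbb{R}^{N\times N}$, that is, a unique solution for which all eigenvalues of $A_\epsilon-GX_\epsilon$ lie in the open left half plane. It satisfies $X_\epsilon=X_\epsilon^T\succeq0$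 and $X_\epsilon v_0=0$. The matrix $K=R^{-1}B^TX_\epsilon$ is the unique solution of the LQR problem $(A_\epsilon,B,Q,R)$: it is the only gain for which the feedback $u=-Kx$ in $\dot x=A_\epsilon x+Bu$ has, from every initial state, finite cost $\int_0^\infty (x^TQx+u^TRu)\,dt$, not larger than that of any other feedback $u=-Lx$ with $L\in\mathbb{R}^{m\times N}$. Moreover, for every $\epsilon>0$, $(A-BK)v_0=0$, the number $0$ is an eigenvalue of $A-BK$ of algebraic multiplicity one, and all other eigenvalues of $A-BK$ lie in the open left half plane. -/

import Mathlib

open MeasureTheory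
open scoped Matrix ENNReal

namespace CPLQR

/-- A real square matrix is Hurwitz if all its complex eigenvalues lie in the open left
half plane. -/
def IsHurwitz {n : Type*} [Fintype n] [DecidableEq n] (A : Matrix n n ℝ) : Prop :=
  ∀ μ ∈ spectrum ℂ (A.map (algebraMap ℝ ℂ)), μ.re < 0

/-- Consensus stability: zero is an eigenvalue of algebraic multiplicity exactly one, and every
other complex eigenvalue lies in the open left half plane. -/
def IsConsensusStable {n : Type*} [Fintype n] [DecidableEq n] (A : Matrix n n ℝ) : Prop :=
  (A.map (algebraMap ℝ ℂ)).charpoly.rootMultiplicity 0 = 1 ∧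
    ∀ μ ∈ spectrum ℂ (A.map (algebraMap ℝ ℂ)), μ ≠ 0 → μ.re < 0

/-- The shifted state matrix `A - ε v₀ w₀ᵀ`. -/
def shifted {n : Type*} (A : Matrix n n ℝ) (v₀ w₀ : n → ℝ) (ε : ℝ) : Matrix n n ℝ :=
  A - ε • Matrix.vecMulVec v₀ w₀

/-- The feedback matrix `R⁻¹ Bᵀ X`. -/
noncomputable def gain {n m : Type*} [Fintype n] [Fintype m] [DecidableEq m]
    (B : Matrix n m ℝ) (R : Matrix m m ℝ) (X : Matrix n n ℝ) : Matrix m n ℝ :=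
  R⁻¹ * Bᵀ * X

/-- `X` solves the algebraic Riccati equation `Aᵀ X + X A + Q - X G X = 0`,
`G = B R⁻¹ Bᵀ`. -/
def IsAreSolution {n m : Type*} [Fintype n] [Fintype m] [DecidableEq m]
    (A : Matrix n n ℝ) (B : Matrix n m ℝ) (Q : Matrix n n ℝ) (R : Matrix m m ℝ)
    (X : Matrix n n ℝ) : Prop :=
  Aᵀ * X + X * A + Q - X * (B * R⁻¹ * Bᵀ) * X = 0

/-- A solution of the algebraic Riccati equation is stabilizing if `A - B R⁻¹ Bᵀ X` is
Hurwitz. -/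
def IsStabilizingSolution {n m : Type*} [Fintype n] [DecidableEq n] [Fintype m] [DecidableEq m]
    (A : Matrix n n ℝ) (B : Matrix n m ℝ) (Q : Matrix n n ℝ) (R : Matrix m m ℝ)
    (X : Matrix n n ℝ) : Prop :=
  IsAreSolution A B Q R X ∧ IsHurwitz (A - B * gain B R X)

/-- The state at time `t` of `x' = A x + B u` under the feedback `u = -L x`, started at `x₀`. -/
noncomputable def state {n m : Type*} [Fintype n] [DecidableEq n] [Fintype m]
    (A : Matrix n n ℝ) (B : Matrix n m ℝ) (L : Matrix m n ℝ) (x₀ : n → ℝ) (t : ℝ) : n → ℝ :=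
  NormedSpace.exp (t • (A - B * L)) *ᵥ x₀

/-- The quadratic cost `∫₀^∞ (xᵀ Q x + uᵀ R u) dt` of the feedback `u = -L x` started at `x₀`.
It is extended-real valued; for `Q, R ⪰ 0` the integrand is nonnegative. -/
noncomputable def cost {n m : Type*} [Fintype n] [DecidableEq n] [Fintype m]
    (A : Matrix n n ℝ) (B : Matrix n m ℝ) (Q : Matrix n n ℝ) (R : Matrix m m ℝ)
    (L : Matrix m n ℝ) (x₀ : n → ℝ) : ℝ≥0∞ :=
  ∫⁻ t in Set.Ioi (0 : ℝ), ENNReal.ofReal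
    (state A B L x₀ t ⬝ᵥ (Q *ᵥ state A B L x₀ t) +
      (-(L *ᵥ state A B L x₀ t)) ⬝ᵥ (R *ᵥ (-(L *ᵥ state A B L x₀ t))))

/-- `K` solves the LQR problem `(A, B, Q, R)`: from every initial state the feedback `u = -K x`
has finite cost, and no linear state feedback has smaller cost. -/
def SolvesLQR {n m : Type*} [Fintype n] [DecidableEq n] [Fintype m]
    (A : Matrix n n ℝ) (B : Matrix n m ℝ) (Q : Matrix n n ℝ) (R : Matrix m m ℝ)
    (K : Matrix m n ℝ) : Prop :=
  ∀ x₀ : n → ℝ, cost A B Q R K x₀ < ∞ ∧ ∀ L : Matrix m n ℝ, cost A B Q R K x₀ ≤ cost A B Q R L x₀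

end CPLQR

namespace CPLQR

open Filter Topology

/-! Write `G = B R⁻¹ Bᵀ`. Subtracting `ε v₀ w₀ᵀ` moves the simple eigenvalue `0` of `A` to `-ε` and
fixes the rest of the spectrum (`charpoly_add_vecMulVec_mul`), so `A_ε` is Hurwitz. The Riccati
equation then has a solution `X ⪰ 0`: a supersolution of least trace cannot be improved by a Newton
step (`exists_newton_step`), hence solves the equation. It is stabilizing by
`isHurwitz_of_riccati_supersolution`, and uniqueness is injectivity of a Sylvester operator.

Since `Q v₀ = 0`, the Riccati form at `v₀` reads `-2ε v₀ᵀ X v₀ = (X v₀)ᵀ G (X v₀) ≥ 0`, so `X v₀ =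
0`. Thus `v₀` is still an eigenvector of `A_ε - G X` for `-ε`, and adding `ε v₀ w₀ᵀ` back moves this
eigenvalue to `0`: the result is `A - B K`.

For the LQR problem, completing the square gives `d/dt xᵀXx = s - l` along every feedback, with `l`
the running cost and `s ≥ 0` vanishing for the gain of `X`. A competing feedback need not stabilize,
but `ker Q ⊆ ker X` yields `xᵀXx ≤ c l`, so finite cost forces `xᵀXx` to become arbitrarily small at
late times. Hence every cost is at least `x₀ᵀXx₀`, with equality only for this gain. -/

/-! ### Hurwitz matrices and the Cayley transform. -/

theorem exists_mulVec_eq_smul_iff_mem_spectrum {n : Type*} [Fintype n] [DecidableEq n]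
    (A : Matrix n n ℂ) (μ : ℂ) :
    μ ∈ spectrum ℂ A ↔ ∃ z : n → ℂ, z ≠ 0 ∧ A *ᵥ z = μ • z := by
  rw [← Matrix.spectrum_toLin', ← Module.End.hasEigenvalue_iff_mem_spectrum]
  constructor
  · intro h
    obtain ⟨z, hz⟩ := h.exists_hasEigenvector
    exact ⟨z, hz.2, by simpa using hz.apply_eq_smul⟩
  · rintro ⟨z, hz, h⟩
    exact Module.End.hasEigenvalue_of_hasEigenvector (x := z)
      ⟨Module.End.mem_eigenspace_iff.2 (by simpa using h), hz⟩

/-- A complex eigenvector of a real matrix, split into real and imaginary parts. -/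
theorem isHurwitz_iff_real {n : Type*} [Fintype n] [DecidableEq n] (F : Matrix n n ℝ) :
    IsHurwitz F ↔ ∀ (α β : ℝ) (a b : n → ℝ), F *ᵥ a = α • a - β • b → F *ᵥ b = β • a + α • b →
      0 ≤ α → a = 0 ∧ b = 0 := by
  constructor
  · intro h α β a b ha hb hα
    by_contra hne
    have hz : (fun i => (⟨a i, b i⟩ : ℂ)) ≠ 0 := by
      intro h0
      exact hne ⟨funext fun i => congrArg Complex.re (congrFun h0 i),
        funext fun i => congrArg Complex.im (congrFun h0 i)⟩
    have hmem : (⟨α, β⟩ : ℂ) ∈ spectrum ℂ (F.map (algebraMap ℝ ℂ)) := by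
      refine (exists_mulVec_eq_smul_iff_mem_spectrum _ _).2 ⟨_, hz, ?_⟩
      ext i
      have hai := congrFun ha i
      have hbi := congrFun hb i
      simp only [Matrix.mulVec, dotProduct, Pi.sub_apply, Pi.add_apply, Pi.smul_apply,
        smul_eq_mul] at hai hbi
      apply Complex.ext
      · simp [Matrix.mulVec, dotProduct, hai]
      · simp [Matrix.mulVec, dotProduct, hbi]
        ring
    have := h _ hmem
    simp at this
    linarith
  · intro h μ hμ
    obtain ⟨z, hz, hez⟩ := (exists_mulVec_eq_smul_iff_mem_spectrum _ _).1 hμ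
    by_contra hre
    have := h μ.re μ.im (fun i => (z i).re) (fun i => (z i).im) ?_ ?_ (not_lt.1 hre)
    · exact hz (funext fun i => Complex.ext (congrFun this.1 i) (congrFun this.2 i))
    · ext i
      simpa [Matrix.mulVec, dotProduct] using congrArg Complex.re (congrFun hez i)
    · ext i
      have := congrArg Complex.im (congrFun hez i)
      simp [Matrix.mulVec, dotProduct] at this
      simp [Matrix.mulVec, dotProduct, this]
      ring

/-- Gelfand's formula: the spectral radius is below some `r < 1`, so eventually `‖C ^ k‖ ≤ r ^ k`.
-/
theorem tendsto_pow_zero_of_spectrum_norm_lt_one {n : Type*} [Fintype n] [DecidableEq n]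
    (C : Matrix n n ℂ) (hC : ∀ μ ∈ spectrum ℂ C, ‖μ‖ < 1) :
    Tendsto (fun k : ℕ => C ^ k) atTop (𝓝 0) := by
  cases isEmpty_or_nonempty n
  · have : ∀ k : ℕ, C ^ k = 0 := fun k => Subsingleton.elim _ _
    simp [this]
  let _ : NormedRing (Matrix n n ℂ) := Matrix.linftyOpNormedRing
  let _ : NormedAlgebra ℂ (Matrix n n ℂ) := Matrix.linftyOpNormedAlgebra
  have hr : spectralRadius ℂ C < 1 := by
    have := spectrum.spectralRadius_lt_of_forall_lt C (r := 1) (fun μ hμ => by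
      simpa [← NNReal.coe_lt_coe] using hC μ hμ)
    simpa using this
  obtain ⟨r, hr1, hr2⟩ := ENNReal.lt_iff_exists_nnreal_btwn.1 hr
  have hev := (spectrum.pow_nnnorm_pow_one_div_tendsto_nhds_spectralRadius C).eventually_lt_const hr1
  have hr3 : r < 1 := by simpa using hr2
  have hle : ∀ᶠ k : ℕ in atTop, ‖C ^ k‖ ≤ (r : ℝ) ^ k := by
    filter_upwards [hev, eventually_gt_atTop 0] with k hk hk0
    have h1 := ENNReal.rpow_le_rpow hk.le (Nat.cast_nonneg k : (0 : ℝ) ≤ k)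
    rw [← ENNReal.rpow_mul, one_div_mul_cancel (by positivity), ENNReal.rpow_one,
      ENNReal.rpow_natCast] at h1
    have h2 : ‖C ^ k‖₊ ≤ r ^ k := by exact_mod_cast h1
    exact_mod_cast h2
  exact squeeze_zero_norm' hle
    (tendsto_pow_atTop_nhds_zero_of_lt_one r.2 (by exact_mod_cast hr3))

/-- The Cayley transform of a Hurwitz matrix is a power-stable matrix. -/
theorem IsHurwitz.exists_cayley {n : Type*} [Fintype n] [DecidableEq n] {F : Matrix n n ℝ}
    (hF : IsHurwitz F) :
    IsUnit (1 - F) ∧ Tendsto (fun k : ℕ => ((1 + F) * (1 - F)⁻¹) ^ k) atTop (𝓝 0) := by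
  have hu : IsUnit (1 - F) := by
    rw [← Matrix.mulVec_injective_iff_isUnit, ← Matrix.coe_mulVecLin,
      injective_iff_map_eq_zero]
    intro a ha
    have ha' : F *ᵥ a = a := by
      have : a - F *ᵥ a = 0 := by simpa [Matrix.sub_mulVec] using ha
      exact (sub_eq_zero.1 this).symm
    exact ((isHurwitz_iff_real F).1 hF 1 0 a 0 (by simp [ha']) (by simp) zero_le_one).1
  refine ⟨hu, ?_⟩
  set S := (1 - F)⁻¹ with hS
  have hS1 : (1 - F) * S = 1 := Matrix.mul_nonsing_inv _ ((Matrix.isUnit_iff_isUnit_det _).1 hu)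
  let φ : Matrix n n ℝ →+* Matrix n n ℂ := (algebraMap ℝ ℂ).mapMatrix
  have hφS : (1 - φ F) * φ S = 1 := by
    rw [← map_one φ, ← map_sub, ← map_mul, hS1]
  have key : Tendsto (fun k : ℕ => φ ((1 + F) * S) ^ k) atTop (𝓝 0) := by
    apply tendsto_pow_zero_of_spectrum_norm_lt_one
    intro μ hμ
    obtain ⟨z, hz, hez⟩ := (exists_mulVec_eq_smul_iff_mem_spectrum _ _).1 hμ
    set y := φ S *ᵥ z with hy
    have hzy : z = y - φ F *ᵥ y := by
      have : (1 - φ F) *ᵥ y = z := by rw [hy, Matrix.mulVec_mulVec, hφS, Matrix.one_mulVec]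
      rw [← this, Matrix.sub_mulVec, Matrix.one_mulVec]
    have hy0 : y ≠ 0 := by
      intro h
      apply hz
      rw [hzy, h]
      simp
    have he : y + φ F *ᵥ y = μ • (y - φ F *ᵥ y) := by
      rw [← hzy, ← hez, map_mul, map_add, map_one, ← Matrix.mulVec_mulVec, ← hy,
        Matrix.add_mulVec, Matrix.one_mulVec]
    have he' : (1 + μ) • (φ F *ᵥ y) = (μ - 1) • y := by
      rw [smul_sub] at he
      rw [add_smul, sub_smul, one_smul, one_smul, sub_eq_of_eq_add' (a := μ • y) (b := y)]
      rw [eq_sub_iff_add_eq] at he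
      rw [← he]; abel
    have hμ1 : 1 + μ ≠ 0 := by
      intro h
      have hμ : μ = -1 := by linear_combination h
      rw [h, zero_smul, hμ] at he'
      have : (-1 - 1 : ℂ) = 0 := (smul_eq_zero.1 he'.symm).resolve_right hy0
      norm_num at this
    -- The inverse Cayley transform of `μ`; its real part is negative exactly when `‖μ‖ < 1`.
    have hmem : (μ - 1) / (1 + μ) ∈ spectrum ℂ (F.map (algebraMap ℝ ℂ)) := by
      refine (exists_mulVec_eq_smul_iff_mem_spectrum _ _).2 ⟨y, hy0, ?_⟩
      have : φ F *ᵥ y = ((μ - 1) / (1 + μ)) • y := by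
        rw [div_eq_inv_mul, mul_smul, ← he', smul_smul, inv_mul_cancel₀ hμ1, one_smul]
      exact this
    have hre := hF _ hmem
    have hpos : 0 < Complex.normSq (1 + μ) := Complex.normSq_pos.2 hμ1
    rw [Complex.div_re, ← add_div, div_lt_iff₀ hpos, zero_mul] at hre
    simp at hre
    have : Complex.normSq μ < 1 := by
      rw [Complex.normSq_apply]; nlinarith
    rw [Complex.normSq_eq_norm_sq] at this
    nlinarith [norm_nonneg μ]
  refine tendsto_pi_nhds.2 fun i => tendsto_pi_nhds.2 fun j => ?_
  have h1 := (tendsto_pi_nhds.1 (tendsto_pi_nhds.1 key i) j)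
  have h2 := (Complex.continuous_re.tendsto _).comp h1
  have h3 : ∀ k : ℕ, (Complex.re ∘ fun k : ℕ => (φ ((1 + F) * S) ^ k) i j) k
      = (((1 + F) * S) ^ k) i j := by
    intro k
    simp only [Function.comp, ← map_pow]
    rfl
  rw [funext h3] at h2
  simpa using h2

/-! ### Sylvester and Lyapunov equations. -/

/-- Turns continuous-time equations into discrete-time ones, so that decay of powers replaces decay
of the matrix exponential. -/
theorem cayley_sub {n : Type*} [Fintype n] [DecidableEq n] {F F' : Matrix n n ℝ}
    (hF : IsUnit (1 - F)) (hF' : IsUnit (1 - F')) (D : Matrix n n ℝ) :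
    ((1 + F) * (1 - F)⁻¹)ᵀ * D * ((1 + F') * (1 - F')⁻¹) - D =
      (2 : ℝ) • ((1 - F)⁻¹ᵀ * (Fᵀ * D + D * F') * (1 - F')⁻¹) := by
  set S := (1 - F)⁻¹
  set S' := (1 - F')⁻¹
  have hS : (1 - F) * S = 1 := Matrix.mul_nonsing_inv _ ((Matrix.isUnit_iff_isUnit_det _).1 hF)
  have hS' : (1 - F') * S' = 1 :=
    Matrix.mul_nonsing_inv _ ((Matrix.isUnit_iff_isUnit_det _).1 hF')
  have hSt : Sᵀ * (1 - Fᵀ) = 1 := by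
    rw [← Matrix.transpose_one, ← Matrix.transpose_sub, ← Matrix.transpose_mul, hS]
  have hD : D = Sᵀ * ((1 - Fᵀ) * D * (1 - F')) * S' := by
    calc D = (Sᵀ * (1 - Fᵀ)) * D * ((1 - F') * S') := by rw [hSt, hS', one_mul, mul_one]
      _ = _ := by noncomm_ring
  have h1 : ((1 + F) * S)ᵀ * D * ((1 + F') * S') = Sᵀ * ((1 + Fᵀ) * D * (1 + F')) * S' := by
    rw [Matrix.transpose_mul, Matrix.transpose_add, Matrix.transpose_one]
    noncomm_ring
  calc _ = Sᵀ * ((1 + Fᵀ) * D * (1 + F')) * S' - Sᵀ * ((1 - Fᵀ) * D * (1 - F')) * S' := by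
        rw [h1, ← hD]
    _ = Sᵀ * ((2 : ℝ) • (Fᵀ * D + D * F')) * S' := by
        rw [← sub_mul, ← mul_sub, two_smul]
        congr 2
        noncomm_ring
    _ = _ := by rw [Matrix.mul_smul, Matrix.smul_mul]

/-- The Sylvester operator `D ↦ Fᵀ D + D F'` of two Hurwitz matrices is injective. -/
theorem eq_zero_of_sylvester {n : Type*} [Fintype n] [DecidableEq n] {F F' : Matrix n n ℝ}
    (hF : IsHurwitz F) (hF' : IsHurwitz F') {D : Matrix n n ℝ} (h : Fᵀ * D + D * F' = 0) :
    D = 0 := by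
  obtain ⟨hu, ht⟩ := hF.exists_cayley
  obtain ⟨hu', ht'⟩ := hF'.exists_cayley
  have hc := cayley_sub hu hu' D
  rw [h] at hc
  set C := (1 + F) * (1 - F)⁻¹
  set C' := (1 + F') * (1 - F')⁻¹
  have hc1 : Cᵀ * D * C' = D := by
    rw [mul_zero, zero_mul, smul_zero] at hc
    exact sub_eq_zero.1 hc
  have hk : ∀ k : ℕ, (C ^ k)ᵀ * D * C' ^ k = D := by
    intro k
    induction k with
    | zero => simp
    | succ k ih =>
      calc _ = (C ^ k)ᵀ * (Cᵀ * D * C') * C' ^ k := by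
            simp only [pow_succ', Matrix.transpose_mul, mul_assoc]
        _ = D := by rw [hc1, ih]
  have hlim : Tendsto (fun k : ℕ => (C ^ k)ᵀ * D * C' ^ k) atTop (𝓝 (0ᵀ * D * 0)) := by
    refine Tendsto.mul (Tendsto.mul ?_ tendsto_const_nhds) ht'
    exact ((continuous_id.matrix_transpose).tendsto _).comp ht
  rw [funext hk] at hlim
  simpa using tendsto_nhds_unique tendsto_const_nhds hlim

/-- `P` is symmetric because `Pᵀ` solves the same equation. The form of `P` does not increase under
the Cayley transform `C`, and `C ^ k → 0`, so its value at `x` is at least the limit `0`. -/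
theorem posSemidef_of_lyapunov {n : Type*} [Fintype n] [DecidableEq n] {F P S : Matrix n n ℝ}
    (hF : IsHurwitz F) (hS : S.PosSemidef) (h : Fᵀ * P + P * F + S = 0) : P.PosSemidef := by
  have hsymm : Pᵀ = P := by
    have hSt : Sᵀ = S := hS.isHermitian
    have h2 : Fᵀ * Pᵀ + Pᵀ * F + S = 0 := by
      have := congrArg Matrix.transpose h
      simp only [Matrix.transpose_add, Matrix.transpose_mul, Matrix.transpose_transpose, hSt,
        Matrix.transpose_zero] at this
      rw [← this]; abel
    have h3 : Fᵀ * (Pᵀ - P) + (Pᵀ - P) * F = 0 := by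
      have : Fᵀ * (Pᵀ - P) + (Pᵀ - P) * F =
        (Fᵀ * Pᵀ + Pᵀ * F + S) - (Fᵀ * P + P * F + S) := by noncomm_ring
      rw [this, h, h2, sub_zero]
    exact sub_eq_zero.1 (eq_zero_of_sylvester hF hF h3)
  obtain ⟨hu, ht⟩ := hF.exists_cayley
  have hc := cayley_sub hu hu P
  rw [eq_neg_of_add_eq_zero_left h] at hc
  set C := (1 + F) * (1 - F)⁻¹
  set T := (1 - F)⁻¹
  refine Matrix.PosSemidef.of_dotProduct_mulVec_nonneg hsymm fun x => ?_
  rw [star_trivial]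
  have hstep : ∀ y : n → ℝ, (C *ᵥ y) ⬝ᵥ P *ᵥ (C *ᵥ y) ≤ y ⬝ᵥ P *ᵥ y := by
    intro y
    have h1 := congrArg (fun M : Matrix n n ℝ => y ⬝ᵥ M *ᵥ y) hc
    have h2 := hS.dotProduct_mulVec_nonneg (T *ᵥ y)
    simp only [Matrix.sub_mulVec, dotProduct_sub, Matrix.smul_mulVec, dotProduct_smul,
      ← Matrix.mulVec_mulVec, Matrix.neg_mulVec, Matrix.mulVec_neg, dotProduct_neg,
      Matrix.dotProduct_mulVec _ Cᵀ, Matrix.dotProduct_mulVec _ Tᵀ, Matrix.vecMul_transpose,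
      smul_eq_mul] at h1
    rw [star_trivial] at h2
    linarith
  have hle : ∀ k : ℕ, ((C ^ k) *ᵥ x) ⬝ᵥ P *ᵥ ((C ^ k) *ᵥ x) ≤ x ⬝ᵥ P *ᵥ x := by
    intro k
    induction k with
    | zero => simp
    | succ k ih =>
      rw [pow_succ', ← Matrix.mulVec_mulVec]
      exact (hstep _).trans ih
  have hcont : Continuous fun M : Matrix n n ℝ => (M *ᵥ x) ⬝ᵥ P *ᵥ (M *ᵥ x) := by fun_prop
  have hlim := (hcont.tendsto 0).comp ht
  simp only [Matrix.zero_mulVec, zero_dotProduct] at hlim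
  exact le_of_tendsto hlim (Eventually.of_forall hle)

/-- The injective Lyapunov operator acts on a finite-dimensional space, hence is surjective. -/
theorem exists_lyapunov {n : Type*} [Fintype n] [DecidableEq n] {F S : Matrix n n ℝ}
    (hF : IsHurwitz F) (hS : S.PosSemidef) :
    ∃ P : Matrix n n ℝ, P.PosSemidef ∧ Fᵀ * P + P * F + S = 0 := by
  let T : Matrix n n ℝ →ₗ[ℝ] Matrix n n ℝ :=
    LinearMap.mulLeft ℝ Fᵀ + LinearMap.mulRight ℝ F
  have hinj : Function.Injective T := by
    rw [injective_iff_map_eq_zero]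
    intro D hD
    exact eq_zero_of_sylvester hF hF (by simpa [T] using hD)
  obtain ⟨P, hP⟩ := LinearMap.injective_iff_surjective.1 hinj (-S)
  have hP' : Fᵀ * P + P * F + S = 0 := by
    have : Fᵀ * P + P * F = -S := by simpa [T] using hP
    rw [this, neg_add_cancel]
  exact ⟨P, posSemidef_of_lyapunov hF hS hP', hP'⟩

/-! ### The Riccati equation. -/

theorem dotProduct_mulVec_symm {n : Type*} [Fintype n] {X : Matrix n n ℝ} (hX : Xᵀ = X)
    (x y : n → ℝ) : x ⬝ᵥ X *ᵥ y = (X *ᵥ x) ⬝ᵥ y := by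
  rw [Matrix.dotProduct_mulVec, ← Matrix.mulVec_transpose, hX]

/-- The quadratic form of the Riccati residual. -/
theorem dotProduct_riccati_mulVec {n : Type*} [Fintype n] {A G Q X : Matrix n n ℝ}
    (hX : Xᵀ = X) (x : n → ℝ) :
    x ⬝ᵥ (Aᵀ * X + X * A + Q - X * G * X) *ᵥ x =
      2 * ((X *ᵥ x) ⬝ᵥ A *ᵥ x) + x ⬝ᵥ Q *ᵥ x - (X *ᵥ x) ⬝ᵥ G *ᵥ (X *ᵥ x) := by
  have h1 : x ⬝ᵥ Aᵀ *ᵥ (X *ᵥ x) = (X *ᵥ x) ⬝ᵥ A *ᵥ x := by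
    rw [Matrix.dotProduct_mulVec, Matrix.vecMul_transpose, dotProduct_comm]
  simp only [Matrix.sub_mulVec, Matrix.add_mulVec, ← Matrix.mulVec_mulVec, dotProduct_sub,
    dotProduct_add, h1, dotProduct_mulVec_symm hX x]
  ring

/-- If `A` is Hurwitz, every positive semidefinite supersolution of the Riccati equation is
stabilizing. -/
theorem isHurwitz_of_riccati_supersolution {n : Type*} [Fintype n] [DecidableEq n]
    {A G Q X : Matrix n n ℝ} (hA : IsHurwitz A) (hG : G.PosSemidef) (hQ : Q.PosSemidef)
    (hX : X.PosSemidef) (hE : (-(Aᵀ * X + X * A + Q - X * G * X)).PosSemidef) :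
    IsHurwitz (A - G * X) := by
  rw [isHurwitz_iff_real] at hA ⊢
  intro α β a b ha hb hα
  have hXt : Xᵀ = X := hX.isHermitian
  have haA : A *ᵥ a = α • a - β • b + G *ᵥ (X *ᵥ a) := by
    rw [← ha, Matrix.sub_mulVec, Matrix.mulVec_mulVec, sub_add_cancel]
  have hbA : A *ᵥ b = β • a + α • b + G *ᵥ (X *ᵥ b) := by
    rw [← hb, Matrix.sub_mulVec, Matrix.mulVec_mulVec, sub_add_cancel]
  have hEa := hE.dotProduct_mulVec_nonneg a
  have hEb := hE.dotProduct_mulVec_nonneg b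
  rw [star_trivial, Matrix.neg_mulVec, dotProduct_neg, dotProduct_riccati_mulVec hXt] at hEa hEb
  have hQa := hQ.dotProduct_mulVec_nonneg a
  have hQb := hQ.dotProduct_mulVec_nonneg b
  have hXa := hX.dotProduct_mulVec_nonneg a
  have hXb := hX.dotProduct_mulVec_nonneg b
  have hGa := hG.dotProduct_mulVec_nonneg (X *ᵥ a)
  have hGb := hG.dotProduct_mulVec_nonneg (X *ᵥ b)
  rw [star_trivial] at hQa hQb hXa hXb hGa hGb
  rw [dotProduct_mulVec_symm hXt] at hXa hXb
  rw [haA] at hEa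
  rw [hbA] at hEb
  simp only [dotProduct_add, dotProduct_sub, dotProduct_smul, smul_eq_mul] at hEa hEb
  have hab : (X *ᵥ b) ⬝ᵥ a = (X *ᵥ a) ⬝ᵥ b := by
    rw [← dotProduct_mulVec_symm hXt, dotProduct_comm]
  rw [hab] at hEb
  have h1 := mul_nonneg hα hXa
  have h2 := mul_nonneg hα hXb
  -- Adding `hEa` and `hEb` cancels the `β` terms and leaves nonnegative terms with sum at most
  -- zero. So `G X` kills `a` and `b`, which then span an unstable mode of `A` unless both vanish.
  have hga : (X *ᵥ a) ⬝ᵥ G *ᵥ (X *ᵥ a) = 0 := by linarith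
  have hgb : (X *ᵥ b) ⬝ᵥ G *ᵥ (X *ᵥ b) = 0 := by linarith
  have hza := (hG.dotProduct_mulVec_zero_iff (X *ᵥ a)).1 (by rwa [star_trivial])
  have hzb := (hG.dotProduct_mulVec_zero_iff (X *ᵥ b)).1 (by rwa [star_trivial])
  exact hA α β a b (by rw [haA, hza, add_zero]) (by rw [hbA, hzb, add_zero]) hα

/-- One Newton step for the Riccati equation decreases a supersolution. -/
theorem exists_newton_step {n : Type*} [Fintype n] [DecidableEq n]
    {A G Q X : Matrix n n ℝ} (hA : IsHurwitz A) (hG : G.PosSemidef) (hQ : Q.PosSemidef)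
    (hX : X.PosSemidef) (hE : (-(Aᵀ * X + X * A + Q - X * G * X)).PosSemidef) :
    ∃ Y : Matrix n n ℝ, Y.PosSemidef ∧ (-(Aᵀ * Y + Y * A + Q - Y * G * Y)).PosSemidef ∧
      (X - Y).PosSemidef ∧ (X = Y → Aᵀ * X + X * A + Q - X * G * X = 0) := by
  have hF := isHurwitz_of_riccati_supersolution hA hG hQ hX hE
  have hXt : Xᵀ = X := hX.isHermitian
  have hGt : Gᵀ = G := hG.isHermitian
  have hXGX : (X * G * X).PosSemidef := by
    have := hG.conjTranspose_mul_mul_same X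
    rwa [hX.isHermitian] at this
  have hFt : (A - G * X)ᵀ = Aᵀ - X * G := by
    rw [Matrix.transpose_sub, Matrix.transpose_mul, hXt, hGt]
  obtain ⟨Y, hY, hYe⟩ := exists_lyapunov hF (hQ.add hXGX)
  rw [hFt] at hYe
  -- `Y` solves the equation linearized at `X`, so only the quadratic remainder survives.
  have hres : -(Aᵀ * Y + Y * A + Q - Y * G * Y) = (X - Y) * G * (X - Y) := by
    have : -(Aᵀ * Y + Y * A + Q - Y * G * Y) = (X - Y) * G * (X - Y) -
      ((Aᵀ - X * G) * Y + Y * (A - G * X) + (Q + X * G * X)) := by noncomm_ring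
    rw [this, hYe, sub_zero]
  have hD : (A - G * X)ᵀ * (X - Y) + (X - Y) * (A - G * X) +
      -(Aᵀ * X + X * A + Q - X * G * X) = 0 := by
    rw [hFt, ← neg_eq_zero, ← hYe]
    noncomm_ring
  refine ⟨Y, hY, ?_, posSemidef_of_lyapunov hF hE hD, ?_⟩
  · rw [hres]
    have := hG.conjTranspose_mul_mul_same (X - Y)
    rwa [Matrix.conjTranspose_sub, hX.isHermitian, hY.isHermitian] at this
  · intro hXY
    rw [← hXY, sub_self, mul_zero, neg_eq_zero] at hres
    exact hres

theorem isClosed_setOf_posSemidef {n : Type*} [Fintype n] :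
    IsClosed {X : Matrix n n ℝ | X.PosSemidef} := by
  simp only [Matrix.posSemidef_iff_dotProduct_mulVec, Set.ofPred_and, Set.ofPred_forall]
  refine IsClosed.inter ?_ (isClosed_iInter fun x => ?_)
  · exact isClosed_eq (continuous_id.matrix_conjTranspose) continuous_id
  · exact isClosed_le continuous_const (by fun_prop)

/-- Testing on `eᵢ ± eⱼ` bounds `|X i j|` by the mean of two diagonal entries. This makes trace
sublevel sets bounded. -/
theorem _root_.Matrix.PosSemidef.abs_apply_le_trace {n : Type*} [Fintype n]
    {X : Matrix n n ℝ} (hX : X.PosSemidef) (i j : n) : |X i j| ≤ X.trace := by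
  classical
  have hdiag : ∀ k, X k k ≤ X.trace := fun k =>
    Finset.single_le_sum (f := fun k => X k k) (fun _ _ => hX.diag_nonneg) (Finset.mem_univ k)
  have hsymm : X j i = X i j := hX.isHermitian.apply i j
  have h1 := hX.dotProduct_mulVec_nonneg (Pi.single i 1 + Pi.single j 1)
  have h2 := hX.dotProduct_mulVec_nonneg (Pi.single i 1 - Pi.single j 1)
  simp [Matrix.mulVec_add, Matrix.mulVec_sub, dotProduct_add, add_dotProduct, sub_dotProduct,
    dotProduct_sub, hsymm] at h1 h2
  have := hdiag i
  have := hdiag j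
  rw [abs_le]
  constructor <;> linarith

theorem isCompact_setOf_posSemidef_trace_le {n : Type*} [Fintype n] (c : ℝ) :
    IsCompact {X : Matrix n n ℝ | X.PosSemidef ∧ X.trace ≤ c} := by
  have hK : IsCompact (Set.univ.pi fun _ : n => Set.univ.pi fun _ : n => Set.Icc (-c) c) :=
    isCompact_univ_pi fun _ => isCompact_univ_pi fun _ => isCompact_Icc
  refine IsCompact.of_isClosed_subset hK ?_ ?_
  · exact isClosed_setOf_posSemidef.inter (isClosed_le continuous_id.matrix_trace continuous_const)
  · rintro X ⟨hX, hc⟩ i - j -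
    exact abs_le.1 ((hX.abs_apply_le_trace i j).trans hc)

/-- A Riccati equation with Hurwitz `A` has a positive semidefinite solution. It is found by
minimizing the trace over the positive semidefinite supersolutions. -/
theorem exists_posSemidef_riccati {n : Type*} [Fintype n] [DecidableEq n]
    {A G Q : Matrix n n ℝ} (hA : IsHurwitz A) (hG : G.PosSemidef) (hQ : Q.PosSemidef) :
    ∃ X : Matrix n n ℝ, X.PosSemidef ∧ Aᵀ * X + X * A + Q - X * G * X = 0 := by
  obtain ⟨X₁, hX₁, hX₁e⟩ := exists_lyapunov hA hQ
  have hE₁ : (-(Aᵀ * X₁ + X₁ * A + Q - X₁ * G * X₁)).PosSemidef := by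
    rw [hX₁e, zero_sub, neg_neg]
    have := hG.conjTranspose_mul_mul_same X₁
    rwa [hX₁.isHermitian] at this
  let S : Set (Matrix n n ℝ) := {X | X.PosSemidef ∧ X.trace ≤ X₁.trace} ∩
    {X | (-(Aᵀ * X + X * A + Q - X * G * X)).PosSemidef}
  have hScpt : IsCompact S := by
    refine (isCompact_setOf_posSemidef_trace_le _).inter_right ?_
    exact isClosed_setOf_posSemidef.preimage
      (f := fun X : Matrix n n ℝ => -(Aᵀ * X + X * A + Q - X * G * X)) (by fun_prop)
  obtain ⟨X, ⟨⟨hX, hXt⟩, hXE⟩, hmin⟩ := hScpt.exists_isMinOn ⟨X₁, ⟨hX₁, le_rfl⟩, hE₁⟩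
    (f := Matrix.trace) continuous_id.matrix_trace.continuousOn
  obtain ⟨Y, hY, hYE, hXY, hsol⟩ := exists_newton_step hA hG hQ hX hXE
  have htr : Y.trace ≤ X.trace := by
    have := hXY.trace_nonneg
    rw [Matrix.trace_sub] at this
    linarith
  have hXYtr : X.trace ≤ Y.trace := hmin ⟨⟨hY, htr.trans hXt⟩, hYE⟩
  have : X - Y = 0 := hXY.trace_eq_zero_iff.1 (by rw [Matrix.trace_sub]; linarith)
  exact ⟨X, hX, hsol (sub_eq_zero.1 this)⟩

/-- A symmetric stabilizing solution of a Riccati equation is the only stabilizing solution. -/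
theorem riccati_stabilizing_unique {n : Type*} [Fintype n] [DecidableEq n]
    {A G Q X Y : Matrix n n ℝ} (hGt : Gᵀ = G) (hXt : Xᵀ = X)
    (hX : Aᵀ * X + X * A + Q - X * G * X = 0) (hY : Aᵀ * Y + Y * A + Q - Y * G * Y = 0)
    (hXs : IsHurwitz (A - G * X)) (hYs : IsHurwitz (A - G * Y)) : Y = X := by
  -- Mixing the two closed loops makes the difference of the equations linear in `X - Y` without any
  -- symmetry of `Y`.
  have h : (A - G * X)ᵀ * (X - Y) + (X - Y) * (A - G * Y) = 0 := by
    rw [Matrix.transpose_sub, Matrix.transpose_mul, hXt, hGt]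
    have : (Aᵀ - X * G) * (X - Y) + (X - Y) * (A - G * Y) =
      (Aᵀ * X + X * A + Q - X * G * X) - (Aᵀ * Y + Y * A + Q - Y * G * Y) := by noncomm_ring
    rw [this, hX, hY, sub_zero]
  exact (sub_eq_zero.1 (eq_zero_of_sylvester hXs hYs h)).symm

/-! ### The rank-one spectral shift. -/

/-- A rank-one perturbation along an eigenvector `v` moves the eigenvalue `-ε` to `0` and keeps the
rest of the spectrum. -/
theorem charpoly_add_vecMulVec_mul {n : Type*} [Fintype n] [DecidableEq n] (M : Matrix n n ℂ)
    (v w : n → ℂ) (ε : ℂ) (hv : M *ᵥ v = -ε • v) (hwv : w ⬝ᵥ v = 1) :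
    (M + ε • Matrix.vecMulVec v w).charpoly * (Polynomial.X + Polynomial.C ε) =
      M.charpoly * Polynomial.X := by
  refine Polynomial.funext fun x => ?_
  simp only [Polynomial.eval_mul, Polynomial.eval_add, Polynomial.eval_X, Polynomial.eval_C,
    Matrix.eval_charpoly]
  by_cases hx : x + ε = 0
  · have hv0 : v ≠ 0 := by rintro rfl; simp at hwv
    have : (Matrix.scalar n x - M).det = 0 := by
      refine Matrix.exists_mulVec_eq_zero_iff.1 ⟨v, hv0, ?_⟩
      rw [Matrix.sub_mulVec, hv, eq_neg_of_add_eq_zero_left hx]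
      ext i; simp
    rw [this, hx, mul_zero, zero_mul]
  -- Since `(x - M) v = (x + ε) v`, the perturbation `ε v wᵀ` equals `(x - M) (c v wᵀ)`; the
  -- remaining factor has determinant `1 - c = x / (x + ε)`.
  · set c := ε / (x + ε)
    have hfac : Matrix.scalar n x - (M + ε • Matrix.vecMulVec v w) =
        (Matrix.scalar n x - M) *
          (1 - Matrix.replicateCol Unit (c • v) * Matrix.replicateRow Unit w) := by
      rw [← Matrix.vecMulVec_eq, mul_sub, mul_one, sub_mul, Matrix.mul_vecMulVec M,
        Matrix.mul_vecMulVec, Matrix.mulVec_smul M, hv]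
      have hc : c * (x + ε) = ε := div_mul_cancel₀ _ hx
      ext i j
      simp [Matrix.vecMulVec_apply]
      linear_combination (v i * w j) * hc
    rw [hfac, Matrix.det_mul, Matrix.det_one_sub_mul_comm]
    have : (1 - Matrix.replicateRow Unit w * Matrix.replicateCol Unit (c • v) :
        Matrix Unit Unit ℂ).det = 1 - c := by
      simp [hwv]
    rw [this]
    field_simp [c]
    simp only [c]
    field_simp
    ring

theorem charpoly_eq_of_shift {n : Type*} [Fintype n] [DecidableEq n] (M : Matrix n n ℝ)
    (v w : n → ℝ) (ε : ℝ) (hv : M *ᵥ v = -ε • v) (hwv : w ⬝ᵥ v = 1) :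
    ((M + ε • Matrix.vecMulVec v w).map (algebraMap ℝ ℂ)).charpoly *
      (Polynomial.X + Polynomial.C (ε : ℂ)) =
      (M.map (algebraMap ℝ ℂ)).charpoly * Polynomial.X := by
  rw [← charpoly_add_vecMulVec_mul (M.map (algebraMap ℝ ℂ)) (fun i => (v i : ℂ))
    (fun i => (w i : ℂ)) ε]
  · congr 2
    ext i j
    simp [Matrix.vecMulVec_apply]
  · ext i
    have := congrArg Complex.ofReal (congrFun hv i)
    simpa [Matrix.mulVec, dotProduct] using this
  · have := congrArg Complex.ofReal hwv
    simpa [dotProduct] using this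

/-- In the characteristic polynomial identity `M` contributes no root at `0`, so the factor `X`
accounts for the whole multiplicity there; nonzero roots come from `M`. -/
theorem IsHurwitz.isConsensusStable_add {n : Type*} [Fintype n] [DecidableEq n]
    {M : Matrix n n ℝ} {v w : n → ℝ} {ε : ℝ} (hε : 0 < ε) (hv : M *ᵥ v = -ε • v)
    (hwv : w ⬝ᵥ v = 1) (hM : IsHurwitz M) :
    IsConsensusStable (M + ε • Matrix.vecMulVec v w) := by
  have h := charpoly_eq_of_shift M v w ε hv hwv
  have hM0 := (Matrix.charpoly_monic (M.map (algebraMap ℝ ℂ))).ne_zero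
  have hN0 := (Matrix.charpoly_monic
    ((M + ε • Matrix.vecMulVec v w).map (algebraMap ℝ ℂ))).ne_zero
  constructor
  · have h2 := congrArg (Polynomial.rootMultiplicity 0) h
    have hX := Polynomial.X_ne_zero (R := ℂ)
    have hXC := Polynomial.X_add_C_ne_zero (ε : ℂ)
    rw [Polynomial.rootMultiplicity_mul (mul_ne_zero hN0 hXC),
      Polynomial.rootMultiplicity_mul (mul_ne_zero hM0 hX),
      Polynomial.rootMultiplicity_eq_zero (p := Polynomial.X + Polynomial.C (ε : ℂ))
        (by simp [hε.ne']),
      Polynomial.rootMultiplicity_eq_zero (p := (M.map (algebraMap ℝ ℂ)).charpoly)] at h2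
    · have : Polynomial.rootMultiplicity 0 (Polynomial.X : Polynomial ℂ) = 1 := by
        simpa using Polynomial.rootMultiplicity_X_sub_C_self (x := (0 : ℂ))
      rw [this] at h2
      simpa using h2
    · intro h0
      have := hM 0 (Matrix.mem_spectrum_iff_isRoot_charpoly.2 h0)
      simp at this
  · intro μ hμ hμ0
    have hroot := Matrix.mem_spectrum_iff_isRoot_charpoly.1 hμ
    have h2 := congrArg (Polynomial.eval μ) h
    rw [Polynomial.eval_mul, hroot.eq_zero, zero_mul, Polynomial.eval_mul,
      Polynomial.eval_X] at h2
    exact hM μ (Matrix.mem_spectrum_iff_isRoot_charpoly.2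
      ((mul_eq_zero.1 h2.symm).resolve_right hμ0))

/-- The same identity read backwards: the simple root `0` is used up by the factor `X`, and the only
possible new root is `-ε`. -/
theorem IsConsensusStable.isHurwitz_of_add {n : Type*} [Fintype n] [DecidableEq n]
    {M : Matrix n n ℝ} {v w : n → ℝ} {ε : ℝ} (hε : 0 < ε) (hv : M *ᵥ v = -ε • v)
    (hwv : w ⬝ᵥ v = 1) (hN : IsConsensusStable (M + ε • Matrix.vecMulVec v w)) :
    IsHurwitz M := by
  have h := charpoly_eq_of_shift M v w ε hv hwv
  have hM0 := (Matrix.charpoly_monic (M.map (algebraMap ℝ ℂ))).ne_zero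
  have hN0 := (Matrix.charpoly_monic
    ((M + ε • Matrix.vecMulVec v w).map (algebraMap ℝ ℂ))).ne_zero
  intro μ hμ
  have hroot := Matrix.mem_spectrum_iff_isRoot_charpoly.1 hμ
  by_cases hμ0 : μ = 0
  · subst hμ0
    exfalso
    have h2 := congrArg (Polynomial.rootMultiplicity 0) h
    have hX := Polynomial.X_ne_zero (R := ℂ)
    have hXC := Polynomial.X_add_C_ne_zero (ε : ℂ)
    rw [Polynomial.rootMultiplicity_mul (mul_ne_zero hN0 hXC),
      Polynomial.rootMultiplicity_mul (mul_ne_zero hM0 hX),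
      Polynomial.rootMultiplicity_eq_zero (p := Polynomial.X + Polynomial.C (ε : ℂ))
        (by simp [hε.ne']), hN.1] at h2
    have h3 : Polynomial.rootMultiplicity 0 (Polynomial.X : Polynomial ℂ) = 1 := by
      simpa using Polynomial.rootMultiplicity_X_sub_C_self (x := (0 : ℂ))
    have h4 := (Polynomial.rootMultiplicity_pos hM0).2 hroot
    omega
  · have h2 := congrArg (Polynomial.eval μ) h
    rw [Polynomial.eval_mul, Polynomial.eval_mul, hroot.eq_zero, zero_mul] at h2
    rcases mul_eq_zero.1 h2 with h3 | h3
    · exact hN.2 μ (Matrix.mem_spectrum_iff_isRoot_charpoly.2 h3) hμ0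
    · have : μ = -(ε : ℂ) := by
        simp at h3
        exact eq_neg_of_add_eq_zero_left h3
      rw [this]
      simpa using hε

/-! ### Domination of quadratic forms. -/

theorem exists_dotProduct_mulVec_self_le {n : Type*} [Fintype n] [DecidableEq n]
    (E : Matrix n n ℝ) : ∃ c : ℝ, 0 ≤ c ∧ ∀ y : n → ℝ, (E *ᵥ y) ⬝ᵥ (E *ᵥ y) ≤ c * (y ⬝ᵥ y) := by
  refine ⟨∑ i, ∑ j, E i j ^ 2, by positivity, fun y => ?_⟩
  rw [dotProduct, Finset.sum_mul]
  refine Finset.sum_le_sum fun i _ => ?_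
  have := Finset.sum_mul_sq_le_sq_mul_sq Finset.univ (fun j => E i j) y
  simpa [Matrix.mulVec, dotProduct, sq] using this

/-- A semidefinite form whose kernel contains that of `Q` is dominated by a multiple of `Q`. -/
theorem exists_form_le_mul_form {n : Type*} [Fintype n] [DecidableEq n] {Q X : Matrix n n ℝ}
    (hQ : Q.PosSemidef) (hX : X.PosSemidef) (hker : ∀ x, Q *ᵥ x = 0 → X *ᵥ x = 0) :
    ∃ c : ℝ, 0 ≤ c ∧ ∀ x : n → ℝ, x ⬝ᵥ X *ᵥ x ≤ c * (x ⬝ᵥ Q *ᵥ x) := by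
  open scoped MatrixOrder in
  obtain ⟨C, hC⟩ := CStarAlgebra.nonneg_iff_eq_star_mul_self.mp hQ.nonneg
  open scoped MatrixOrder in
  obtain ⟨D, hD⟩ := CStarAlgebra.nonneg_iff_eq_star_mul_self.mp hX.nonneg
  have hform : ∀ (M : Matrix n n ℝ) (x : n → ℝ),
      x ⬝ᵥ (star M * M) *ᵥ x = (M *ᵥ x) ⬝ᵥ (M *ᵥ x) := by
    intro M x
    rw [← Matrix.mulVec_mulVec, Matrix.dotProduct_mulVec, Matrix.star_eq_conjTranspose,
      Matrix.conjTranspose_eq_transpose_of_trivial, Matrix.vecMul_transpose]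
  have hCD : ∀ x, C *ᵥ x = 0 → D *ᵥ x = 0 := by
    intro x hx
    have h1 : X *ᵥ x = 0 := hker x (by rw [hC, ← Matrix.mulVec_mulVec, hx, Matrix.mulVec_zero])
    have h2 := hform D x
    rw [← hD, h1, dotProduct_zero] at h2
    exact dotProduct_self_eq_zero.1 h2.symm
  -- As `ker C ⊆ ker D`, `D` factors as `E C`: take `D ∘ g` for a section `g` of `C` over its range
  -- and extend it linearly.
  obtain ⟨g, hg⟩ := (C.mulVecLin.rangeRestrict).exists_rightInverse_of_surjective
    (LinearMap.range_rangeRestrict _)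
  obtain ⟨E, hE⟩ := LinearMap.exists_extend (D.mulVecLin ∘ₗ g)
  have hED : ∀ x, D *ᵥ x = LinearMap.toMatrix' E *ᵥ (C *ᵥ x) := by
    intro x
    have h1 := LinearMap.congr_fun hE (C.mulVecLin.rangeRestrict x)
    have h2 := congrArg Subtype.val (LinearMap.congr_fun hg (C.mulVecLin.rangeRestrict x))
    simp at h1 h2
    rw [LinearMap.toMatrix'_mulVec, h1, ← sub_eq_zero, ← Matrix.mulVec_sub]
    exact hCD _ (by rw [Matrix.mulVec_sub, h2, sub_self])
  obtain ⟨c, hc0, hc⟩ := exists_dotProduct_mulVec_self_le (LinearMap.toMatrix' E)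
  refine ⟨c, hc0, fun x => ?_⟩
  rw [hC, hD, hform, hform, hED]
  exact hc _

/-! ### Trajectories and dissipation. -/

theorem hasDerivAt_dotProduct {n : Type*} [Fintype n] {f g : ℝ → n → ℝ} {f' g' : n → ℝ} {t : ℝ}
    (hf : HasDerivAt f f' t) (hg : HasDerivAt g g' t) :
    HasDerivAt (fun s => f s ⬝ᵥ g s) (f' ⬝ᵥ g t + f t ⬝ᵥ g') t := by
  have := HasDerivAt.fun_sum (u := Finset.univ)
    (fun i _ => (hasDerivAt_pi.1 hf i).fun_mul (hasDerivAt_pi.1 hg i))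
  simpa only [dotProduct, ← Finset.sum_add_distrib] using this

theorem hasDerivAt_const_mulVec {m n : Type*} [Fintype m] [Fintype n] (X : Matrix m n ℝ)
    {f : ℝ → n → ℝ} {f' : n → ℝ} {t : ℝ} (hf : HasDerivAt f f' t) :
    HasDerivAt (fun s => X *ᵥ f s) (X *ᵥ f') t :=
  (LinearMap.toContinuousLinearMap X.mulVecLin).hasFDerivAt.comp_hasDerivAt t hf

theorem hasDerivAt_state {n m : Type*} [Fintype n] [DecidableEq n] [Fintype m]
    (A : Matrix n n ℝ) (B : Matrix n m ℝ) (L : Matrix m n ℝ) (x₀ : n → ℝ) (t : ℝ) :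
    HasDerivAt (state A B L x₀) ((A - B * L) *ᵥ state A B L x₀ t) t := by
  let _ : NormedRing (Matrix n n ℝ) := Matrix.linftyOpNormedRing
  let _ : NormedAlgebra ℝ (Matrix n n ℝ) := Matrix.linftyOpNormedAlgebra
  let ev : Matrix n n ℝ →ₗ[ℝ] (n → ℝ) := (Matrix.mulVecBilin ℝ ℝ).flip x₀
  have h := (LinearMap.toContinuousLinearMap ev).hasFDerivAt.comp_hasDerivAt t
    (hasDerivAt_exp_smul_const' (A - B * L) t)
  rw [state, Matrix.mulVec_mulVec]
  exact h

theorem continuous_state {n m : Type*} [Fintype n] [DecidableEq n] [Fintype m]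
    (A : Matrix n n ℝ) (B : Matrix n m ℝ) (L : Matrix m n ℝ) (x₀ : n → ℝ) :
    Continuous (state A B L x₀) :=
  continuous_iff_continuousAt.2 fun t => (hasDerivAt_state A B L x₀ t).continuousAt

theorem state_zero {n m : Type*} [Fintype n] [DecidableEq n] [Fintype m]
    (A : Matrix n n ℝ) (B : Matrix n m ℝ) (L : Matrix m n ℝ) (x₀ : n → ℝ) :
    state A B L x₀ 0 = x₀ := by
  simp [state]

/-- Dissipation along a trajectory: `V` is a storage function, `ℓ` the running cost and `s` the
excess supply. -/
theorem storage_add_supply_le_integral {V l s : ℝ → ℝ} {c : ℝ} (hl : Continuous l)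
    (hs : Continuous s) (hV : ∀ t, HasDerivAt V (s t - l t) t) (hV0 : ∀ t, 0 ≤ V t)
    (hl0 : ∀ t, 0 ≤ l t) (hs0 : ∀ t, 0 ≤ s t) (hVl : ∀ t, V t ≤ c * l t)
    (hint : IntegrableOn l (Set.Ioi 0)) {T : ℝ} (hT : 0 ≤ T) :
    V 0 + ∫ t in 0..T, s t ≤ ∫ t in Set.Ioi 0, l t := by
  have hVc : Continuous V := continuous_iff_continuousAt.2 fun t => (hV t).continuousAt
  have hVint : IntegrableOn V (Set.Ioi 0) := by
    refine Integrable.mono' (hint.const_mul c) hVc.aestronglyMeasurable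
      (Eventually.of_forall fun t => ?_)
    rw [Real.norm_of_nonneg (hV0 t)]
    exact hVl t
  refine le_of_forall_pos_le_add fun δ hδ => ?_
  -- `V` is integrable on the half-line, so it cannot stay above `δ` beyond `T`. This replaces
  -- convergence of the state to zero.
  obtain ⟨T', hT', hVT⟩ : ∃ T', T ≤ T' ∧ V T' ≤ δ := by
    by_contra! hcon
    have hconst : IntegrableOn (fun _ : ℝ => δ) (Set.Ioi T) := by
      refine Integrable.mono' (hVint.mono_set (Set.Ioi_subset_Ioi hT))
        aestronglyMeasurable_const ?_
      refine (ae_restrict_iff' measurableSet_Ioi).2 (Eventually.of_forall fun t ht => ?_)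
      rw [Real.norm_of_nonneg hδ.le]
      exact (hcon t (le_of_lt ht)).le
    rw [integrableOn_const_iff] at hconst
    simp [hδ.ne'] at hconst
  have hT'0 := hT.trans hT'
  have hftc : ∫ t in 0..T', (s t - l t) = V T' - V 0 :=
    intervalIntegral.integral_eq_sub_of_hasDerivAt (fun t _ => hV t)
      ((hs.sub hl).intervalIntegrable _ _)
  rw [intervalIntegral.integral_sub (hs.intervalIntegrable _ _) (hl.intervalIntegrable _ _)]
    at hftc
  have h1 : ∫ t in 0..T', l t ≤ ∫ t in Set.Ioi 0, l t := by
    rw [intervalIntegral.integral_of_le hT'0]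
    exact setIntegral_mono_set hint (Eventually.of_forall hl0)
      Set.Ioc_subset_Ioi_self.eventuallyLE
  have h2 : ∫ t in 0..T, s t ≤ ∫ t in 0..T', s t :=
    intervalIntegral.integral_mono_interval le_rfl hT hT' (Eventually.of_forall hs0)
      (hs.intervalIntegrable _ _)
  linarith

theorem integrableOn_of_lintegral_lt_top {l : ℝ → ℝ} (hl : Continuous l) (hl0 : ∀ t, 0 ≤ l t)
    (hfin : ∫⁻ t in Set.Ioi (0 : ℝ), ENNReal.ofReal (l t) < ∞) : IntegrableOn l (Set.Ioi 0) :=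
  ⟨hl.aestronglyMeasurable,
    (hasFiniteIntegral_iff_ofReal (Eventually.of_forall hl0)).2 hfin⟩

theorem ofReal_storage_le_lintegral {V l s : ℝ → ℝ} {c : ℝ} (hl : Continuous l)
    (hs : Continuous s) (hV : ∀ t, HasDerivAt V (s t - l t) t) (hV0 : ∀ t, 0 ≤ V t)
    (hl0 : ∀ t, 0 ≤ l t) (hs0 : ∀ t, 0 ≤ s t) (hVl : ∀ t, V t ≤ c * l t) :
    ENNReal.ofReal (V 0) ≤ ∫⁻ t in Set.Ioi (0 : ℝ), ENNReal.ofReal (l t) := by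
  rcases eq_or_ne (∫⁻ t in Set.Ioi (0 : ℝ), ENNReal.ofReal (l t)) ∞ with h | h
  · rw [h]; exact le_top
  · have hint := integrableOn_of_lintegral_lt_top hl hl0 (lt_top_iff_ne_top.2 h)
    rw [← ofReal_integral_eq_lintegral_ofReal hint (Eventually.of_forall hl0)]
    apply ENNReal.ofReal_le_ofReal
    simpa using storage_add_supply_le_integral hl hs hV hV0 hl0 hs0 hVl hint le_rfl

/-- An optimal cost leaves no room for excess supply: by continuity, `s 0 > 0` would give a positive
integral over `[0, 1]`. -/
theorem supply_zero_of_lintegral_le {V l s : ℝ → ℝ} {c : ℝ} (hl : Continuous l)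
    (hs : Continuous s) (hV : ∀ t, HasDerivAt V (s t - l t) t) (hV0 : ∀ t, 0 ≤ V t)
    (hl0 : ∀ t, 0 ≤ l t) (hs0 : ∀ t, 0 ≤ s t) (hVl : ∀ t, V t ≤ c * l t)
    (hle : ∫⁻ t in Set.Ioi (0 : ℝ), ENNReal.ofReal (l t) ≤ ENNReal.ofReal (V 0)) :
    s 0 = 0 := by
  have hint := integrableOn_of_lintegral_lt_top hl hl0 (hle.trans_lt ENNReal.ofReal_lt_top)
  rw [← ofReal_integral_eq_lintegral_ofReal hint (Eventually.of_forall hl0),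
    ENNReal.ofReal_le_ofReal_iff (hV0 0)] at hle
  have h := storage_add_supply_le_integral hl hs hV hV0 hl0 hs0 hVl hint zero_le_one
  by_contra hne
  have hpos : 0 < ∫ t in (0 : ℝ)..1, s t :=
    intervalIntegral.integral_pos zero_lt_one hs.continuousOn (fun t _ => hs0 t)
      ⟨0, ⟨le_rfl, zero_le_one⟩, lt_of_le_of_ne (hs0 0) (Ne.symm hne)⟩
  linarith

/-- With no excess supply, each partial cost is `V 0 - V T ≤ V 0`. -/
theorem lintegral_le_ofReal_storage {V l : ℝ → ℝ} (hl : Continuous l)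
    (hV : ∀ t, HasDerivAt V (-l t) t) (hV0 : ∀ t, 0 ≤ V t) (hl0 : ∀ t, 0 ≤ l t) :
    ∫⁻ t in Set.Ioi (0 : ℝ), ENNReal.ofReal (l t) ≤ ENNReal.ofReal (V 0) := by
  have hb : ∀ T : ℝ, ∫ t in 0..T, l t ≤ V 0 := by
    intro T
    have h : ∫ t in 0..T, -l t = V T - V 0 :=
      intervalIntegral.integral_eq_sub_of_hasDerivAt (fun t _ => hV t)
        (hl.neg.intervalIntegrable _ _)
    rw [intervalIntegral.integral_neg] at h
    linarith [hV0 T]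
  have hint : IntegrableOn l (Set.Ioi 0) := by
    refine integrableOn_Ioi_of_intervalIntegral_norm_bounded (V 0) 0 (b := id) (l := atTop)
      (fun T => (hl.integrableOn_Icc).mono_set Set.Ioc_subset_Icc_self) tendsto_id
      (Eventually.of_forall fun T => ?_)
    simpa only [Real.norm_of_nonneg (hl0 _), id] using hb T
  rw [← ofReal_integral_eq_lintegral_ofReal hint (Eventually.of_forall hl0)]
  exact ENNReal.ofReal_le_ofReal (le_of_tendsto
    (intervalIntegral_tendsto_integral_Ioi 0 hint tendsto_id) (Eventually.of_forall hb))

/-! ### Optimality of the Riccati gain. -/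

/-- Completing the square in the Riccati equation. -/
theorem riccati_complete_square {n m : Type*} [Fintype n] [Fintype m] [DecidableEq m]
    {A X Q : Matrix n n ℝ} {B : Matrix n m ℝ} {R : Matrix m m ℝ} (hR : R.PosDef)
    (hXt : Xᵀ = X) (hX : IsAreSolution A B Q R X) (L : Matrix m n ℝ) (x : n → ℝ) :
    ((A - B * L) *ᵥ x) ⬝ᵥ X *ᵥ x + x ⬝ᵥ X *ᵥ ((A - B * L) *ᵥ x) =
      (L *ᵥ x - gain B R X *ᵥ x) ⬝ᵥ R *ᵥ (L *ᵥ x - gain B R X *ᵥ x) -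
        (x ⬝ᵥ (Q *ᵥ x) + (-(L *ᵥ x)) ⬝ᵥ (R *ᵥ (-(L *ᵥ x)))) := by
  have hRt : Rᵀ = R := hR.isHermitian
  have hform := dotProduct_riccati_mulVec (A := A) (G := B * R⁻¹ * Bᵀ) (Q := Q) hXt x
  rw [show Aᵀ * X + X * A + Q - X * (B * R⁻¹ * Bᵀ) * X = 0 from hX, Matrix.zero_mulVec,
    dotProduct_zero] at hform
  have hB : ∀ y : m → ℝ, (X *ᵥ x) ⬝ᵥ B *ᵥ y = y ⬝ᵥ Bᵀ *ᵥ (X *ᵥ x) := by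
    intro y
    rw [Matrix.dotProduct_mulVec, ← Matrix.mulVec_transpose, dotProduct_comm]
  have hRK : R *ᵥ (gain B R X *ᵥ x) = Bᵀ *ᵥ (X *ᵥ x) := by
    have : R * gain B R X = Bᵀ * X := by
      rw [gain, ← Matrix.mul_assoc, ← Matrix.mul_assoc,
        Matrix.mul_nonsing_inv _ ((Matrix.isUnit_iff_isUnit_det _).1 hR.isUnit), Matrix.one_mul]
    rw [Matrix.mulVec_mulVec, this, Matrix.mulVec_mulVec]
  have hG : (X *ᵥ x) ⬝ᵥ (B * R⁻¹ * Bᵀ) *ᵥ (X *ᵥ x) =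
      (gain B R X *ᵥ x) ⬝ᵥ Bᵀ *ᵥ (X *ᵥ x) := by
    rw [← hB]
    simp only [gain, Matrix.mulVec_mulVec, Matrix.mul_assoc]
  rw [hG] at hform
  have h1 : ((A - B * L) *ᵥ x) ⬝ᵥ X *ᵥ x = (X *ᵥ x) ⬝ᵥ A *ᵥ x - (L *ᵥ x) ⬝ᵥ Bᵀ *ᵥ (X *ᵥ x) := by
    rw [dotProduct_comm, Matrix.sub_mulVec, dotProduct_sub, ← Matrix.mulVec_mulVec, hB]
  have h2 : x ⬝ᵥ X *ᵥ ((A - B * L) *ᵥ x) = ((A - B * L) *ᵥ x) ⬝ᵥ X *ᵥ x := by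
    rw [dotProduct_mulVec_symm hXt, dotProduct_comm]
  rw [h2, h1, Matrix.mulVec_sub, hRK]
  have h3 : (gain B R X *ᵥ x) ⬝ᵥ R *ᵥ (L *ᵥ x) = (L *ᵥ x) ⬝ᵥ Bᵀ *ᵥ (X *ᵥ x) := by
    rw [dotProduct_mulVec_symm hRt, hRK, dotProduct_comm]
  simp only [Matrix.mulVec_neg, dotProduct_neg, neg_dotProduct, dotProduct_sub, sub_dotProduct, h3]
  linarith

/-- The gain of a positive semidefinite Riccati solution that vanishes on the kernel of `Q` is the
unique solution of the LQR problem. -/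
theorem solvesLQR_iff_eq_gain {n m : Type*} [Fintype n] [DecidableEq n] [Fintype m]
    [DecidableEq m] {A X Q : Matrix n n ℝ} {B : Matrix n m ℝ} {R : Matrix m m ℝ}
    (hQ : Q.PosSemidef) (hR : R.PosDef) (hXp : X.PosSemidef) (hX : IsAreSolution A B Q R X)
    (hker : ∀ x, Q *ᵥ x = 0 → X *ᵥ x = 0) (K : Matrix m n ℝ) :
    SolvesLQR A B Q R K ↔ K = gain B R X := by
  obtain ⟨c, hc0, hc⟩ := exists_form_le_mul_form hQ hXp hker
  let V : Matrix m n ℝ → (n → ℝ) → ℝ → ℝ := fun L x₀ t =>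
    state A B L x₀ t ⬝ᵥ X *ᵥ state A B L x₀ t
  let l : Matrix m n ℝ → (n → ℝ) → ℝ → ℝ := fun L x₀ t =>
    state A B L x₀ t ⬝ᵥ (Q *ᵥ state A B L x₀ t) +
      (-(L *ᵥ state A B L x₀ t)) ⬝ᵥ (R *ᵥ (-(L *ᵥ state A B L x₀ t)))
  let s : Matrix m n ℝ → (n → ℝ) → ℝ → ℝ := fun L x₀ t =>
    (L *ᵥ state A B L x₀ t - gain B R X *ᵥ state A B L x₀ t) ⬝ᵥ
      R *ᵥ (L *ᵥ state A B L x₀ t - gain B R X *ᵥ state A B L x₀ t)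
  have hQ0 : ∀ x : n → ℝ, 0 ≤ x ⬝ᵥ Q *ᵥ x := fun x => by
    simpa using hQ.dotProduct_mulVec_nonneg x
  have hR0 : ∀ u : m → ℝ, 0 ≤ u ⬝ᵥ R *ᵥ u := fun u => by
    simpa using hR.posSemidef.dotProduct_mulVec_nonneg u
  have hl : ∀ L x₀, Continuous (l L x₀) := fun L x₀ => by
    have := continuous_state A B L x₀
    fun_prop
  have hs : ∀ L x₀, Continuous (s L x₀) := fun L x₀ => by
    have := continuous_state A B L x₀
    fun_prop
  have hV : ∀ L x₀ t, HasDerivAt (V L x₀) (s L x₀ t - l L x₀ t) t := fun L x₀ t => by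
    have h := hasDerivAt_state A B L x₀ t
    have h2 := hasDerivAt_dotProduct h (hasDerivAt_const_mulVec X h)
    rwa [riccati_complete_square hR (show Xᵀ = X from hXp.isHermitian) hX L] at h2
  have hV0 : ∀ L x₀ t, 0 ≤ V L x₀ t := fun L x₀ t => by
    simpa using hXp.dotProduct_mulVec_nonneg (state A B L x₀ t)
  have hl0 : ∀ L x₀ t, 0 ≤ l L x₀ t := fun L x₀ t => add_nonneg (hQ0 _) (hR0 _)
  have hs0 : ∀ L x₀ t, 0 ≤ s L x₀ t := fun L x₀ t => hR0 _
  have hVl : ∀ L x₀ t, V L x₀ t ≤ c * l L x₀ t := fun L x₀ t =>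
    (hc _).trans (mul_le_mul_of_nonneg_left (le_add_of_nonneg_right (hR0 _)) hc0)
  have hVinit : ∀ L x₀, V L x₀ 0 = x₀ ⬝ᵥ X *ᵥ x₀ := fun L x₀ => by
    simp only [V, state_zero]
  have hlow : ∀ L x₀, ENNReal.ofReal (x₀ ⬝ᵥ X *ᵥ x₀) ≤ cost A B Q R L x₀ := fun L x₀ => by
    rw [← hVinit L x₀]
    exact ofReal_storage_le_lintegral (hl L x₀) (hs L x₀) (hV L x₀) (hV0 L x₀) (hl0 L x₀)
      (hs0 L x₀) (hVl L x₀)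
  have hup : ∀ x₀, cost A B Q R (gain B R X) x₀ ≤ ENNReal.ofReal (x₀ ⬝ᵥ X *ᵥ x₀) := fun x₀ => by
    rw [← hVinit (gain B R X) x₀]
    refine lintegral_le_ofReal_storage (hl _ x₀) (fun t => ?_) (hV0 _ x₀) (hl0 _ x₀)
    have h := hV (gain B R X) x₀ t
    simpa only [s, sub_self, Matrix.mulVec_zero, dotProduct_zero, zero_sub] using h
  constructor
  · intro hK
    -- Only time `0` is needed, because the initial state is arbitrary.
    have hzero : ∀ x₀ : n → ℝ, K *ᵥ x₀ = gain B R X *ᵥ x₀ := by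
      intro x₀
      have hle := ((hK x₀).2 (gain B R X)).trans (hup x₀)
      rw [← hVinit K x₀] at hle
      have h0 := supply_zero_of_lintegral_le (hl K x₀) (hs K x₀) (hV K x₀) (hV0 K x₀) (hl0 K x₀)
        (hs0 K x₀) (hVl K x₀) hle
      simp only [s, state_zero] at h0
      by_contra hne
      have := hR.dotProduct_mulVec_pos (sub_ne_zero.2 hne)
      rw [star_trivial] at this
      exact this.ne' h0
    exact Matrix.ext_of_mulVec_single fun i => hzero _
  · rintro rfl x₀
    exact ⟨(hup x₀).trans_lt ENNReal.ofReal_lt_top, fun L => (hup x₀).trans (hlow L x₀)⟩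

/-- A positive semidefinite Riccati solution vanishes on an eigenvector of `A` with negative
eigenvalue that lies in the kernel of `Q`. -/
theorem riccati_mulVec_eq_zero {n : Type*} [Fintype n] {A G Q X : Matrix n n ℝ}
    (hG : G.PosSemidef) (hXp : X.PosSemidef) (hX : Aᵀ * X + X * A + Q - X * G * X = 0)
    {v : n → ℝ} {ε : ℝ} (hε : 0 < ε) (hAv : A *ᵥ v = -ε • v) (hQv : Q *ᵥ v = 0) :
    X *ᵥ v = 0 := by
  have hXt : Xᵀ = X := hXp.isHermitian
  have h := dotProduct_riccati_mulVec (A := A) (G := G) (Q := Q) hXt v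
  have hG0 := hG.dotProduct_mulVec_nonneg (X *ᵥ v)
  have hX0 := hXp.dotProduct_mulVec_nonneg v
  rw [star_trivial] at hG0 hX0
  rw [hX, hAv, hQv, Matrix.zero_mulVec, dotProduct_zero, dotProduct_smul,
    ← dotProduct_mulVec_symm hXt, smul_eq_mul] at h
  refine (hXp.dotProduct_mulVec_zero_iff v).1 ?_
  rw [star_trivial]
  nlinarith

end CPLQR

/-! ### The consensus-preserving LQR theorem. -/

theorem lemma2 {n m : Type*} [Fintype n] [DecidableEq n] [Fintype m] [DecidableEq m]
    (A : Matrix n n ℝ) (B : Matrix n m ℝ) (Q : Matrix n n ℝ) (R : Matrix m m ℝ)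
    (v₀ w₀ : n → ℝ)
    (hA : CPLQR.IsConsensusStable A)
    (hv₀ : A *ᵥ v₀ = 0) (hw₀ : w₀ ᵥ* A = 0) (hwv : w₀ ⬝ᵥ v₀ = 1)
    (hQ : Q.PosSemidef) (hR : R.PosDef)
    (hker : LinearMap.ker Q.mulVecLin = Submodule.span ℝ {v₀})
    (ε : ℝ) (hε : 0 < ε) :
    ∃ X : Matrix n n ℝ,
      CPLQR.IsStabilizingSolution (CPLQR.shifted A v₀ w₀ ε) B Q R X ∧
      (∀ Y : Matrix n n ℝ,
        CPLQR.IsStabilizingSolution (CPLQR.shifted A v₀ w₀ ε) B Q R Y → Y = X) ∧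
      X.PosSemidef ∧
      (∀ K : Matrix m n ℝ,
        CPLQR.SolvesLQR (CPLQR.shifted A v₀ w₀ ε) B Q R K ↔ K = CPLQR.gain B R X) ∧
      X *ᵥ v₀ = 0 ∧
      (A - B * CPLQR.gain B R X) *ᵥ v₀ = 0 ∧
      CPLQR.IsConsensusStable (A - B * CPLQR.gain B R X) := by
  have hGgain : ∀ X, B * CPLQR.gain B R X = (B * R⁻¹ * Bᵀ) * X := fun X => by
    simp only [CPLQR.gain, Matrix.mul_assoc]
  have hG : (B * R⁻¹ * Bᵀ).PosSemidef := by
    simpa using hR.inv.posSemidef.mul_mul_conjTranspose_same B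
  have hshift : CPLQR.shifted A v₀ w₀ ε + ε • Matrix.vecMulVec v₀ w₀ = A := by
    simp [CPLQR.shifted]
  have hshiftv : CPLQR.shifted A v₀ w₀ ε *ᵥ v₀ = -ε • v₀ := by
    simp [CPLQR.shifted, Matrix.sub_mulVec, hv₀, Matrix.smul_mulVec, Matrix.vecMulVec_mulVec, hwv]
  have hAε : CPLQR.IsHurwitz (CPLQR.shifted A v₀ w₀ ε) :=
    CPLQR.IsConsensusStable.isHurwitz_of_add (w := w₀) hε hshiftv hwv (by rwa [hshift])
  have hQv : Q *ᵥ v₀ = 0 := by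
    have : v₀ ∈ LinearMap.ker Q.mulVecLin := hker ▸ Submodule.mem_span_singleton_self v₀
    simpa using this
  obtain ⟨X, hXp, hX⟩ := CPLQR.exists_posSemidef_riccati hAε hG hQ
  have hXv := CPLQR.riccati_mulVec_eq_zero hG hXp hX hε hshiftv hQv
  have hXs : CPLQR.IsHurwitz (CPLQR.shifted A v₀ w₀ ε - B * CPLQR.gain B R X) := by
    rw [hGgain]
    refine CPLQR.isHurwitz_of_riccati_supersolution hAε hG hQ hXp ?_
    rw [hX, neg_zero]
    exact Matrix.PosSemidef.zero
  have hgv : (B * CPLQR.gain B R X) *ᵥ v₀ = 0 := by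
    rw [hGgain, ← Matrix.mulVec_mulVec, hXv, Matrix.mulVec_zero]
  refine ⟨X, ⟨hX, hXs⟩, ?_, hXp, ?_, hXv, ?_, ?_⟩
  · rintro Y ⟨hY, hYs⟩
    rw [hGgain] at hXs hYs
    exact CPLQR.riccati_stabilizing_unique hG.isHermitian hXp.isHermitian hX hY hXs hYs
  · refine CPLQR.solvesLQR_iff_eq_gain hQ hR hXp hX fun x hx => ?_
    have hmem : x ∈ Submodule.span ℝ {v₀} := by
      rw [← hker]
      simpa using hx
    obtain ⟨a, rfl⟩ := Submodule.mem_span_singleton.1 hmem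
    rw [Matrix.mulVec_smul, hXv, smul_zero]
  · rw [Matrix.sub_mulVec, hv₀, hgv, sub_zero]
  -- Undo the shift on the closed loop, where `v₀` still has eigenvalue `-ε`.
  · have h := CPLQR.IsHurwitz.isConsensusStable_add (v := v₀) (w := w₀) hε
      (by rw [Matrix.sub_mulVec, hshiftv, hgv, sub_zero]) hwv hXs
    rwa [sub_add_eq_add_sub, hshift] at h
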